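/- For $\vec n\in\mathbb Z^3$ let $|\vec n|$ be the Euclidean norm, $\vec n^2=|\vec n|^2$, and $\langle\vec n\rangle=(n_1+n_2+n_3)\bmod 2$. Let $\hat\Pi_-=\{\pi(2\vec n+(1,1,1)) : \vec n\in\mathbb Z^3\}$ be the set of antiperiodic momenta (in units of the inverse box size), and for $\tau\in\mathbb C$, $z>0$ let $\Gamma(\tau,z)=\int_z^\infty t^{\tau-1}e^{-t}\,dt$ be the upper incomplete gamma function. The series $$\xi(s)=\sum_{\vec n\in\mathbb Z^3\setminus\{\vec 0\}}\frac{(-1)^{\langle\vec n\rangle}}{|\vec n|^{s}}$$ converges absolutely for $\Re s>3$ and extends uniquely to a meromorphic function $\xi$ on the whole complex plane, which is holomorphic for $\Re s>0$. For every $u_\star>0$ and every complex $s\neq 0$, $$\xi(s)=\frac{1}{\Gamma(s/2)}\Bigg\{-\frac{2u_\star^{s/2}}{s}+\frac{\pi^{3/2}}{2^{s-3}}\sum_{\vec k\in\hat\Pi_-}(\vec k^2)^{\frac{s-3}{2}}\,\Gamma\!\left(\tfrac{3-s}{2},\tfrac{\vec k^2}{4u_\star}\right)+\sum_{\vec n\neq\vec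 0}\frac{(-1)^{\langle\vec n\rangle}}{|\vec n|^{s}}\,\Gamma\!\left(\tfrac s2,u_\star\vec n^2\right)\Bigg\},$$ where $1/\Gamma(s/2)$ is read as $0$ at the poles $s=-2,-4,\dots$ of $\Gamma(s/2)$. Both sums converge absolutely and rapidly: for all $u_\star>0$ and $s\in\mathbb C$ there is a constant $C$ (depending on $s$ and $u_\star$) such that the term with index $\vec k$ is bounded in absolute value by $C e^{-\vec k^2/(4u_\star)}$ and the term with index $\vec n$ by $C e^{-u_\star\vec n^2}$. -/

import Mathlib

noncomputable section

namespace LatticeZeta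

/-- The integer vector `n`, seen as a vector of Euclidean 3-space (so that `‖vec n‖ = |n|`). -/
def vec (n : Fin 3 → ℤ) : EuclideanSpace ℝ (Fin 3) :=
  WithLp.toLp 2 (fun i => (n i : ℝ))

/-- The parity `⟨n⟩ = n₁ + n₂ + n₃ mod 2`, an element of `{0, 1}`. -/
def parity (n : Fin 3 → ℤ) : ℤ := (∑ i, n i) % 2

/-- The set `{π (2 n + (1, 1, 1)) : n ∈ ℤ³}` of antiperiodic momenta of the box of unit size. -/
def antiperiodicMomenta : Set (EuclideanSpace ℝ (Fin 3)) :=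
  {k | ∃ n : Fin 3 → ℤ, ∀ i, k i = Real.pi * (2 * (n i : ℝ) + 1)}

/-- The upper incomplete gamma function `Γ(τ, z) = ∫_z^∞ t^(τ-1) e^(-t) dt` for `z > 0`. -/
def upperGamma (τ : ℂ) (z : ℝ) : ℂ :=
  ∫ t in Set.Ioi z, (t : ℂ) ^ (τ - 1) * ((Real.exp (-t) : ℝ) : ℂ)

/-- The general term `(-1)^⟨n⟩ / |n|^s` of the alternating lattice zeta series. -/
def zetaTerm (s : ℂ) (n : Fin 3 → ℤ) : ℂ :=
  (-1 : ℂ) ^ parity n / ((‖vec n‖ : ℝ) : ℂ) ^ s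

/-- The general term of the sum over antiperiodic momenta. -/
def momentumTerm (u : ℝ) (s : ℂ) (k : EuclideanSpace ℝ (Fin 3)) : ℂ :=
  ((‖k‖ ^ 2 : ℝ) : ℂ) ^ ((s - 3) / 2) * upperGamma ((3 - s) / 2) (‖k‖ ^ 2 / (4 * u))

/-- The general term of the sum over the lattice points `n ≠ 0`. -/
def positionTerm (u : ℝ) (s : ℂ) (n : Fin 3 → ℤ) : ℂ :=
  (-1 : ℂ) ^ parity n / ((‖vec n‖ : ℝ) : ℂ) ^ s * upperGamma (s / 2) (u * ‖vec n‖ ^ 2)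

/-- `ξ` is a meromorphic function on `ℂ` which, on the half-plane `Re s > 3`, is given by the
alternating lattice zeta series. The normal form fixes the values: `ξ` is analytic at removable
singularities and takes the value `0` at poles. -/
structure IsZetaContinuation (ξ : ℂ → ℂ) : Prop where
  meromorphic : MeromorphicNFOn ξ Set.univ
  eq_series : ∀ s : ℂ, 3 < s.re → ξ s = ∑' n : {n : Fin 3 → ℤ // n ≠ 0}, zetaTerm s n

end LatticeZeta

end

namespace LatticeZeta

open MeasureTheory Set Filter Topology

/-! This is Riemann's splitting argument. For `Re s > 3`, `Γ(s/2) ξ(s)` is the Mellin transform at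
`s/2` of `theta t - 1` (`Gamma_mul_tsum_zetaTerm`), and the integral is cut at `u`. Above `u`,
termwise integration gives the position terms. Below `u`, the constant `-1` gives `-u^(s/2) /
(s/2)`, while `theta_eq_dualTheta_inv` and the substitution `t ↦ 1/(4t)` turn `theta` into an
integral of `dualTheta` over `(1/(4u), ∞)`, whose terms are the momentum terms
(`mellin_theta_sub_one`).

Zero is not an antiperiodic momentum, so `dualTheta` decays exponentially and produces no pole at `s
= 3`. Both tails have entire Mellin transforms, and `1/Γ(s/2)` cancels the remaining pole at `s =
0`. Hence `xi u` is entire, and the identity theorem identifies it with every continuation. -/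

/-! ### Incomplete Mellin integrals of exponentials -/

theorem integrableOn_rpow_mul_exp_neg_Ioi (a : ℝ) {u : ℝ} (hu : 0 < u) :
    IntegrableOn (fun t : ℝ => t ^ a * Real.exp (-t)) (Ioi u) := by
  refine integrable_of_isBigO_exp_neg (b := 1 / 2) (by norm_num) ?_ ?_
  · refine ContinuousOn.mul (fun t ht => ?_) (by fun_prop)
    exact (Real.continuousAt_rpow_const t a (Or.inl (hu.trans_le ht).ne')).continuousWithinAt
  · have := (Real.Gamma_integrand_isLittleO a).isBigO
    simpa only [mul_comm] using this

/-- The constant in the Gaussian bound for incomplete Mellin integrals. -/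
noncomputable def tailConst (u a : ℝ) : ℝ :=
  ∫ t in Ioi u, t ^ (a - 1) * Real.exp (-t) * Real.exp u

theorem integrableOn_tail (a : ℝ) {u : ℝ} (hu : 0 < u) (c : ℝ) :
    IntegrableOn (fun t : ℝ => t ^ (a - 1) * Real.exp (-t) * Real.exp u * c) (Ioi u) :=
  ((integrableOn_rpow_mul_exp_neg_Ioi (a - 1) hu).mul_const _).mul_const _

/-- Expanding `(t - u) * (q - 1) ≥ 0` separates `q` from `t`. The remaining weight in `t` is
integrable and independent of `q`, which makes all later bounds uniform in the lattice index. -/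
theorem exp_neg_mul_le {t u q : ℝ} (ht : u ≤ t) (hq : 1 ≤ q) :
    Real.exp (-(t * q)) ≤ Real.exp (-t) * Real.exp u * Real.exp (-(u * q)) := by
  rw [← Real.exp_add, ← Real.exp_add, Real.exp_le_exp]
  nlinarith [mul_nonneg (sub_nonneg.2 ht) (sub_nonneg.2 hq)]

theorem norm_cpow_mul_exp_le (w : ℂ) {t u q : ℝ} (hu : 0 < u) (ht : u < t) (hq : 1 ≤ q) :
    ‖(t : ℂ) ^ (w - 1) * ((Real.exp (-(t * q)) : ℝ) : ℂ)‖ ≤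
      t ^ (w.re - 1) * Real.exp (-t) * Real.exp u * Real.exp (-(u * q)) := by
  rw [norm_mul, Complex.norm_cpow_eq_rpow_re_of_pos (hu.trans ht), Complex.norm_real,
    Real.norm_of_nonneg (Real.exp_pos _).le, mul_assoc, mul_assoc, ← mul_assoc (Real.exp (-t))]
  simp only [Complex.sub_re, Complex.one_re]
  exact mul_le_mul_of_nonneg_left (exp_neg_mul_le ht.le hq)
    (Real.rpow_nonneg (hu.trans ht).le _)

theorem continuousOn_cpow_mul_exp (w : ℂ) (q : ℝ) :
    ContinuousOn (fun t : ℝ => (t : ℂ) ^ (w - 1) * ((Real.exp (-(t * q)) : ℝ) : ℂ)) (Ioi 0) := by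
  refine ContinuousOn.mul (fun t ht => ?_) (by fun_prop)
  exact (Complex.continuousAt_ofReal_cpow_const t _ (Or.inr (ne_of_gt ht))).continuousWithinAt

theorem integrableOn_cpow_mul_exp (w : ℂ) {u q : ℝ} (hu : 0 < u) (hq : 1 ≤ q) :
    IntegrableOn (fun t : ℝ => (t : ℂ) ^ (w - 1) * ((Real.exp (-(t * q)) : ℝ) : ℂ)) (Ioi u) := by
  refine Integrable.mono' (integrableOn_tail w.re hu (Real.exp (-(u * q)))) ?_ ?_
  · exact ((continuousOn_cpow_mul_exp w q).mono (Ioi_subset_Ioi hu.le)).aestronglyMeasurable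
      measurableSet_Ioi
  · exact (ae_restrict_mem measurableSet_Ioi).mono fun t ht => norm_cpow_mul_exp_le w hu ht hq

theorem integral_norm_cpow_mul_exp_le (w : ℂ) {u q : ℝ} (hu : 0 < u) (hq : 1 ≤ q) :
    ∫ t in Ioi u, ‖(t : ℂ) ^ (w - 1) * ((Real.exp (-(t * q)) : ℝ) : ℂ)‖ ≤
      tailConst u w.re * Real.exp (-(u * q)) := by
  rw [tailConst, ← integral_mul_const]
  exact setIntegral_mono_on (integrableOn_cpow_mul_exp w hu hq).norm
    (integrableOn_tail w.re hu _) measurableSet_Ioi fun t ht => norm_cpow_mul_exp_le w hu ht hq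

theorem norm_integral_cpow_mul_exp_le (w : ℂ) {u q : ℝ} (hu : 0 < u) (hq : 1 ≤ q) :
    ‖∫ t in Ioi u, (t : ℂ) ^ (w - 1) * ((Real.exp (-(t * q)) : ℝ) : ℂ)‖ ≤
      tailConst u w.re * Real.exp (-(u * q)) :=
  (norm_integral_le_integral_norm _).trans (integral_norm_cpow_mul_exp_le w hu hq)

/-- Scaling the incomplete gamma integral. -/
theorem cpow_neg_mul_upperGamma (w : ℂ) {u q : ℝ} (hq : 0 < q) (hu : 0 < u) :
    (q : ℂ) ^ (-w) * upperGamma w (u * q) =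
      ∫ t in Ioi u, (t : ℂ) ^ (w - 1) * ((Real.exp (-(t * q)) : ℝ) : ℂ) := by
  have h := integral_comp_mul_right_Ioi
    (fun t : ℝ => (t : ℂ) ^ (w - 1) * ((Real.exp (-t) : ℝ) : ℂ)) u hq
  have hq' : (q : ℂ) ≠ 0 := Complex.ofReal_ne_zero.2 hq.ne'
  rw [upperGamma]
  have h2 : ∫ t in Ioi u, ((t * q : ℝ) : ℂ) ^ (w - 1) * ((Real.exp (-(t * q)) : ℝ) : ℂ) =
      (q : ℂ) ^ (w - 1) *
        ∫ t in Ioi u, (t : ℂ) ^ (w - 1) * ((Real.exp (-(t * q)) : ℝ) : ℂ) := by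
    rw [← integral_const_mul]
    refine setIntegral_congr_fun measurableSet_Ioi fun t ht => ?_
    rw [Complex.ofReal_mul, Complex.mul_cpow_ofReal_nonneg (hu.trans ht).le hq.le]
    ring
  rw [h2] at h
  have h3 : ∫ t in Ioi (u * q), (t : ℂ) ^ (w - 1) * ((Real.exp (-t) : ℝ) : ℂ) =
      (q : ℂ) * ((q : ℂ) ^ (w - 1) *
        ∫ t in Ioi u, (t : ℂ) ^ (w - 1) * ((Real.exp (-(t * q)) : ℝ) : ℂ)) := by
    rw [h, Complex.real_smul, Complex.ofReal_inv, mul_inv_cancel_left₀ hq']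
  rw [h3, Complex.cpow_neg, Complex.cpow_sub _ _ hq', Complex.cpow_one]
  have : (q : ℂ) ^ w ≠ 0 := by simp [Complex.cpow_eq_zero_iff, hq']
  generalize (∫ t in Ioi u, (t : ℂ) ^ (w - 1) * ((Real.exp (-(t * q)) : ℝ) : ℂ)) = J
  field_simp

/-! ### Mellin transforms of truncated exponential series -/

section ExponentialSeries

variable {ι : Type*} {c : ι → ℂ} {q : ι → ℝ} {F : ℝ → ℂ} {u : ℝ}

theorem hasSum_mellin_indicator_Ioi [Countable ι] (hq : ∀ i, 1 ≤ q i) (hc : ∀ i, ‖c i‖ ≤ 1)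
    (hu : 0 < u) (hS : Summable fun i => Real.exp (-(u * q i)))
    (hF : ∀ t, 0 < t → HasSum (fun i => c i * ((Real.exp (-(t * q i)) : ℝ) : ℂ)) (F t)) (w : ℂ) :
    HasSum (fun i => c i * ∫ t in Ioi u, (t : ℂ) ^ (w - 1) * ((Real.exp (-(t * q i)) : ℝ) : ℂ))
      (mellin (indicator (Ioi u) F) w) := by
  have h := hasSum_integral_of_summable_integral_norm (μ := volume.restrict (Ioi u))
    (F := fun i (t : ℝ) => c i * ((t : ℂ) ^ (w - 1) * ((Real.exp (-(t * q i)) : ℝ) : ℂ)))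
    (fun i => (integrableOn_cpow_mul_exp w hu (hq i)).const_mul (c i)) ?_
  · convert! h using 1
    · funext i
      rw [integral_const_mul]
    · rw [mellin]
      have : ∀ t : ℝ, (t : ℂ) ^ (w - 1) • indicator (Ioi u) F t =
          indicator (Ioi u) (fun t : ℝ => (t : ℂ) ^ (w - 1) * F t) t := by
        intro t
        by_cases ht : t ∈ Ioi u <;> simp [ht]
      simp_rw [this]
      rw [setIntegral_indicator measurableSet_Ioi,
        inter_eq_right.2 (Ioi_subset_Ioi hu.le)]
      refine setIntegral_congr_fun measurableSet_Ioi fun t ht => ?_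
      rw [← (hF t (hu.trans ht)).tsum_eq, ← tsum_mul_left]
      exact tsum_congr fun i => by ring
  · refine Summable.of_nonneg_of_le (fun i => integral_nonneg fun t => norm_nonneg _) (fun i => ?_)
      (hS.mul_left (tailConst u w.re))
    simp_rw [norm_mul (c i)]
    rw [integral_const_mul]
    exact (mul_le_of_le_one_left (integral_nonneg fun t => norm_nonneg _) (hc i)).trans
      (integral_norm_cpow_mul_exp_le w hu (hq i))

theorem norm_exponentialSeries_le (hq : ∀ i, 1 ≤ q i) (hc : ∀ i, ‖c i‖ ≤ 1)
    (hu : 0 < u) (hS : Summable fun i => Real.exp (-(u * q i)))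
    (hF : ∀ t, 0 < t → HasSum (fun i => c i * ((Real.exp (-(t * q i)) : ℝ) : ℂ)) (F t))
    {t : ℝ} (ht : u ≤ t) :
    ‖F t‖ ≤ Real.exp u * (∑' i, Real.exp (-(u * q i))) * Real.exp (-t) := by
  have h1 : HasSum (fun i => Real.exp (-t) * Real.exp u * Real.exp (-(u * q i)))
      (Real.exp (-t) * Real.exp u * ∑' i, Real.exp (-(u * q i))) := hS.hasSum.mul_left _
  have h2 := tsum_of_norm_bounded (f := fun i => c i * ((Real.exp (-(t * q i)) : ℝ) : ℂ)) h1
    fun i => by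
      rw [norm_mul, Complex.norm_real, Real.norm_of_nonneg (Real.exp_pos _).le]
      exact (mul_le_of_le_one_left (Real.exp_pos _).le (hc i)).trans (exp_neg_mul_le ht (hq i))
  rw [(hF t (hu.trans_le ht)).tsum_eq] at h2
  linarith

theorem locallyIntegrableOn_indicator_Ioi (hF : ContinuousOn F (Ioi 0)) :
    LocallyIntegrableOn (indicator (Ioi u) F) (Ioi 0) := by
  intro x hx
  obtain ⟨s, hs, hi⟩ := (hF.locallyIntegrableOn (μ := volume) measurableSet_Ioi) x hx
  exact ⟨s, hs, hi.indicator measurableSet_Ioi⟩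

theorem mellin_indicator_Ioi_regular (hq : ∀ i, 1 ≤ q i) (hc : ∀ i, ‖c i‖ ≤ 1)
    (hu : 0 < u) (hS : Summable fun i => Real.exp (-(u * q i)))
    (hF : ∀ t, 0 < t → HasSum (fun i => c i * ((Real.exp (-(t * q i)) : ℝ) : ℂ)) (F t))
    (hcont : ContinuousOn F (Ioi 0)) (w : ℂ) :
    MellinConvergent (indicator (Ioi u) F) w ∧
      DifferentiableAt ℂ (mellin (indicator (Ioi u) F)) w := by
  have htop : indicator (Ioi u) F =O[atTop] fun t => Real.exp (-1 * t) := by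
    refine Asymptotics.IsBigO.of_bound (Real.exp u * ∑' i, Real.exp (-(u * q i))) ?_
    filter_upwards [eventually_gt_atTop u] with t ht
    rw [indicator_of_mem (mem_Ioi.2 ht), Real.norm_of_nonneg (Real.exp_pos _).le, neg_one_mul]
    exact norm_exponentialSeries_le hq hc hu hS hF ht.le
  -- The function vanishes near `0`, so any exponent below `w.re` would do. This is why no condition
  -- on `w` is needed.
  have hbot : indicator (Ioi u) F =O[𝓝[>] 0] (· ^ (-(w.re - 1))) := by
    refine Asymptotics.IsBigO.of_bound 1 ?_
    filter_upwards [nhdsWithin_le_nhds (Iio_mem_nhds hu)] with t ht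
    rw [indicator_of_notMem (by simpa using le_of_lt ht), norm_zero]
    positivity
  exact ⟨mellinConvergent_of_isBigO_rpow_exp one_pos (locallyIntegrableOn_indicator_Ioi hcont)
      htop hbot (by linarith),
    mellin_differentiableAt_of_isBigO_rpow_exp one_pos (locallyIntegrableOn_indicator_Ioi hcont)
      htop hbot (by linarith)⟩

end ExponentialSeries

/-! ### Theta functions as cubes of one-dimensional kernels -/

theorem hasSum_pi_prod {f : ℤ → ℂ} {a : ℂ} (hf : HasSum f a) (hn : Summable fun m => ‖f m‖)
    (d : ℕ) : (Summable fun v : Fin d → ℤ => ‖∏ i, f (v i)‖) ∧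
      HasSum (fun v : Fin d → ℤ => ∏ i, f (v i)) (a ^ d) := by
  induction d with
  | zero => exact ⟨.of_finite, by simp⟩
  | succ d ih =>
    let e : ℤ × (Fin d → ℤ) ≃ (Fin (d + 1) → ℤ) := Fin.consEquiv fun _ => ℤ
    have he : ∀ p : ℤ × (Fin d → ℤ), ∏ i, f (e p i) = f p.1 * ∏ i, f (p.2 i) := by
      intro p
      have : e p = Fin.cons p.1 p.2 := rfl
      rw [this, Fin.prod_univ_succ]
      simp only [Fin.cons_zero, Fin.cons_succ]
    have h1 : Summable fun p : ℤ × (Fin d → ℤ) => ‖f p.1 * ∏ i, f (p.2 i)‖ :=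
      Summable.mul_norm (f := f) (g := fun v : Fin d → ℤ => ∏ i, f (v i)) hn ih.1
    constructor
    · rw [← e.summable_iff]
      exact h1.congr fun p => by rw [Function.comp_apply, he]
    · rw [← e.hasSum_iff, pow_succ']
      refine (hf.mul ih.2 h1.of_norm).congr_fun ?_
      intro p
      exact he p

theorem norm_vec_sq (n : Fin 3 → ℤ) : ‖vec n‖ ^ 2 = ∑ i, (n i : ℝ) ^ 2 := by
  simp [EuclideanSpace.norm_sq_eq, vec]

theorem one_le_norm_vec_sq {n : Fin 3 → ℤ} (hn : n ≠ 0) : 1 ≤ ‖vec n‖ ^ 2 := by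
  obtain ⟨i, hi⟩ := Function.ne_iff.1 hn
  rw [norm_vec_sq]
  refine le_trans ?_ (Finset.single_le_sum (f := fun i => (n i : ℝ) ^ 2)
    (fun j _ => sq_nonneg _) (Finset.mem_univ i))
  have h : (1 : ℤ) ≤ n i ^ 2 := by
    have : 0 < n i ^ 2 := by
      have : n i ≠ 0 := hi
      positivity
    omega
  exact_mod_cast h

theorem neg_one_zpow_parity (n : Fin 3 → ℤ) :
    (-1 : ℂ) ^ parity n = ∏ i, (-1 : ℂ) ^ n i := by
  have h : ∏ i, (-1 : ℂ) ^ n i = (-1 : ℂ) ^ (∑ i, n i) := by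
    simp [Fin.prod_univ_three, Fin.sum_univ_three, zpow_add₀]
  rw [h, parity]
  conv_rhs => rw [← Int.emod_add_mul_ediv (∑ i, n i) 2]
  rw [zpow_add₀ (by norm_num), zpow_mul]
  simp

theorem norm_neg_one_zpow (m : ℤ) : ‖(-1 : ℂ) ^ m‖ = 1 := by simp

/-- The alternating theta function of the lattice `ℤ³`. -/
noncomputable def theta (t : ℝ) : ℂ :=
  ((HurwitzZeta.cosKernel ((1 / 2 : ℝ) : UnitAddCircle) (t / Real.pi) : ℝ) : ℂ) ^ 3

/-- The theta function of the antiperiodic momenta. -/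
noncomputable def dualTheta (t : ℝ) : ℂ :=
  ((HurwitzZeta.evenKernel ((1 / 2 : ℝ) : UnitAddCircle) (4 * Real.pi * t) : ℝ) : ℂ) ^ 3

theorem continuousOn_theta : ContinuousOn theta (Ioi 0) := by
  refine (Complex.continuous_ofReal.comp_continuousOn
    ((HurwitzZeta.continuousOn_cosKernel _).comp (by fun_prop) fun t ht => ?_)).pow 3
  exact div_pos ht Real.pi_pos

theorem continuousOn_dualTheta : ContinuousOn dualTheta (Ioi 0) := by
  refine (Complex.continuous_ofReal.comp_continuousOn
    ((HurwitzZeta.continuousOn_evenKernel _).comp (by fun_prop) fun t ht => ?_)).pow 3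
  exact mul_pos (mul_pos four_pos Real.pi_pos) ht

/-- The character `e^(2πi a n)` at `a = 1/2` is the sign `(-1)^n`. The argument `t / π` absorbs the
`π` in the kernel's Gaussian `e^(-π n² x)`. -/
theorem hasSum_alternating {t : ℝ} (ht : 0 < t) :
    HasSum (fun n : ℤ => (-1 : ℂ) ^ n * ((Real.exp (-(t * (n : ℝ) ^ 2)) : ℝ) : ℂ))
      ((HurwitzZeta.cosKernel ((1 / 2 : ℝ) : UnitAddCircle) (t / Real.pi) : ℝ) : ℂ) := by
  refine (HurwitzZeta.hasSum_int_cosKernel (1 / 2) (div_pos ht Real.pi_pos)).congr_fun fun n => ?_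
  congr 1
  · rw [show 2 * (Real.pi : ℂ) * Complex.I * ((1 / 2 : ℝ) : ℂ) * n = n * (Real.pi * Complex.I) by
      push_cast; ring, Complex.exp_int_mul, Complex.exp_pi_mul_I]
  · have := Real.pi_ne_zero
    congr 2
    field_simp

theorem hasSum_theta {t : ℝ} (ht : 0 < t) :
    (Summable fun n : Fin 3 → ℤ => Real.exp (-(t * ‖vec n‖ ^ 2))) ∧
    HasSum (fun n : Fin 3 → ℤ =>
      (-1 : ℂ) ^ parity n * ((Real.exp (-(t * ‖vec n‖ ^ 2)) : ℝ) : ℂ)) (theta t) := by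
  have h := hasSum_alternating ht
  have key : ∀ n : Fin 3 → ℤ,
      ∏ i, ((-1 : ℂ) ^ n i * ((Real.exp (-(t * (n i : ℝ) ^ 2)) : ℝ) : ℂ)) =
      (-1 : ℂ) ^ parity n * ((Real.exp (-(t * ‖vec n‖ ^ 2)) : ℝ) : ℂ) := by
    intro n
    rw [Finset.prod_mul_distrib, ← neg_one_zpow_parity, ← Complex.ofReal_prod, ← Real.exp_sum,
      norm_vec_sq, Finset.mul_sum, Finset.sum_neg_distrib]
  obtain ⟨h1, h2⟩ := hasSum_pi_prod h h.summable.norm 3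
  simp_rw [key] at h1 h2
  refine ⟨h1.congr fun n => ?_, h2⟩
  rw [norm_mul, norm_neg_one_zpow, one_mul, Complex.norm_real,
    Real.norm_of_nonneg (Real.exp_pos _).le]

theorem summable_exp_ne_zero {t : ℝ} (ht : 0 < t) :
    Summable fun n : {n : Fin 3 → ℤ // n ≠ 0} => Real.exp (-(t * ‖vec n‖ ^ 2)) :=
  (hasSum_theta ht).1.subtype _

theorem hasSum_theta_sub_one {t : ℝ} (ht : 0 < t) :
    HasSum (fun n : {n : Fin 3 → ℤ // n ≠ 0} =>
      (-1 : ℂ) ^ parity n * ((Real.exp (-(t * ‖vec n‖ ^ 2)) : ℝ) : ℂ)) (theta t - 1) := by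
  have h := hasSum_ite_sub_hasSum (hasSum_theta ht).2 0
  have h0 : (-1 : ℂ) ^ parity 0 * ((Real.exp (-(t * ‖vec 0‖ ^ 2)) : ℝ) : ℂ) = 1 := by
    have : ‖vec 0‖ ^ 2 = 0 := by simp [norm_vec_sq]
    rw [this]
    simp [parity]
  rw [h0] at h
  refine (hasSum_subtype_iff_indicator (s := {n : Fin 3 → ℤ | n ≠ 0})
    (f := fun n => (-1 : ℂ) ^ parity n * ((Real.exp (-(t * ‖vec n‖ ^ 2)) : ℝ) : ℂ))).2
      (h.congr_fun fun n => ?_)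
  by_cases hn : n = 0 <;> simp [hn]

/-- The antiperiodic momentum with index `n`. -/
noncomputable def momentum (n : Fin 3 → ℤ) : EuclideanSpace ℝ (Fin 3) :=
  WithLp.toLp 2 fun i => Real.pi * (2 * (n i : ℝ) + 1)

theorem momentum_bijective : Function.Bijective
    fun n : Fin 3 → ℤ => (⟨momentum n, n, fun _ => rfl⟩ : antiperiodicMomenta) := by
  constructor
  · intro m n h
    funext i
    have h1 : Real.pi * (2 * (m i : ℝ) + 1) = Real.pi * (2 * (n i : ℝ) + 1) :=
      congrArg (fun k : antiperiodicMomenta => k.1 i) h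
    have h2 := mul_left_cancel₀ Real.pi_ne_zero h1
    exact_mod_cast (by linarith : (m i : ℝ) = n i)
  · rintro ⟨k, n, hn⟩
    refine ⟨n, Subtype.ext ?_⟩
    ext i
    exact (hn i).symm

/-- The indexing of the antiperiodic momenta by `ℤ³`. -/
noncomputable def momentumEquiv : (Fin 3 → ℤ) ≃ antiperiodicMomenta :=
  Equiv.ofBijective _ momentum_bijective

instance : Countable antiperiodicMomenta := momentumEquiv.symm.injective.countable

theorem norm_momentum_sq (n : Fin 3 → ℤ) :
    ‖(momentumEquiv n : EuclideanSpace ℝ (Fin 3))‖ ^ 2 =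
      ∑ i, (Real.pi * (2 * (n i : ℝ) + 1)) ^ 2 := by
  simp only [EuclideanSpace.norm_sq_eq, Real.norm_eq_abs, sq_abs]
  rfl

theorem one_le_norm_momentum_sq (k : antiperiodicMomenta) :
    1 ≤ ‖(k : EuclideanSpace ℝ (Fin 3))‖ ^ 2 := by
  obtain ⟨n, rfl⟩ := momentumEquiv.surjective k
  rw [norm_momentum_sq]
  refine le_trans ?_ (Finset.single_le_sum (f := fun i => (Real.pi * (2 * (n i : ℝ) + 1)) ^ 2)
    (fun j _ => sq_nonneg _) (Finset.mem_univ 0))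
  have h : (1 : ℤ) ≤ (2 * n 0 + 1) ^ 2 := by
    have : 0 < (2 * n 0 + 1) ^ 2 := by
      have : 2 * n 0 + 1 ≠ 0 := by omega
      positivity
    omega
  have h' : (1 : ℝ) ≤ (2 * (n 0 : ℝ) + 1) ^ 2 := by exact_mod_cast h
  rw [mul_pow]
  nlinarith [Real.pi_gt_three]

theorem hasSum_dualTheta {t : ℝ} (ht : 0 < t) :
    (Summable fun k : antiperiodicMomenta =>
      Real.exp (-(t * ‖(k : EuclideanSpace ℝ (Fin 3))‖ ^ 2))) ∧
    HasSum (fun k : antiperiodicMomenta =>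
      ((Real.exp (-(t * ‖(k : EuclideanSpace ℝ (Fin 3))‖ ^ 2)) : ℝ) : ℂ)) (dualTheta t) := by
  -- The factor `4π` is chosen so that `π (n + 1/2)² · 4πt = t (π(2n+1))²`.
  have h := Complex.hasSum_ofReal.2 (HurwitzZeta.hasSum_int_evenKernel (1 / 2)
    (mul_pos (mul_pos four_pos Real.pi_pos) ht))
  obtain ⟨-, h2⟩ := hasSum_pi_prod h h.summable.norm 3
  have key : HasSum (fun k : antiperiodicMomenta =>
      ((Real.exp (-(t * ‖(k : EuclideanSpace ℝ (Fin 3))‖ ^ 2)) : ℝ) : ℂ)) (dualTheta t) := by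
    rw [← momentumEquiv.hasSum_iff]
    refine h2.congr_fun fun n => ?_
    rw [Function.comp_apply, norm_momentum_sq, ← Complex.ofReal_prod, ← Real.exp_sum,
      Finset.mul_sum, ← Finset.sum_neg_distrib]
    congr 2
    exact Finset.sum_congr rfl fun i _ => by ring
  exact ⟨Complex.summable_ofReal.1 key.summable, key⟩

/-- Poisson summation in each coordinate: the kernel functional equation at `π / t`, cubed. -/
theorem theta_eq_dualTheta_inv {t : ℝ} (ht : 0 < t) :
    theta t = (Real.pi : ℂ) ^ (3 / 2 : ℂ) * ((t : ℂ) ^ (-(3 / 2) : ℂ) * dualTheta (4 * t)⁻¹) := by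
  have hp := Real.pi_pos
  have h := HurwitzZeta.evenKernel_functional_equation ((1 / 2 : ℝ) : UnitAddCircle) (Real.pi / t)
  rw [one_div_div] at h
  have h1 : 4 * Real.pi * (4 * t)⁻¹ = Real.pi / t := by field_simp
  have h2 : (((Real.pi / t) ^ (1 / 2 : ℝ) : ℝ) : ℂ) ^ 3 =
      (Real.pi : ℂ) ^ (3 / 2 : ℂ) * (t : ℂ) ^ (-(3 / 2) : ℂ) := by
    have : ((Real.pi / t) ^ (1 / 2 : ℝ)) ^ 3 = Real.pi ^ (3 / 2 : ℝ) * t ^ (-(3 / 2) : ℝ) := by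
      rw [← Real.rpow_natCast, ← Real.rpow_mul (by positivity), Real.rpow_neg ht.le,
        ← div_eq_mul_inv, ← Real.div_rpow hp.le ht.le]
      norm_num
    rw [← Complex.ofReal_pow, this, Complex.ofReal_mul, Complex.ofReal_cpow hp.le,
      Complex.ofReal_cpow ht.le]
    push_cast
    rfl
  have h3 : ((Real.pi / t) ^ (1 / 2 : ℝ) : ℝ) ≠ 0 := by positivity
  rw [← mul_assoc, ← h2, dualTheta, h1, h, theta, Complex.ofReal_mul, mul_pow, ← mul_assoc,
    ← mul_pow, ← Complex.ofReal_mul, mul_one_div_cancel h3]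
  simp

/-! ### Absolute convergence of the lattice series -/

theorem vec_injective : Function.Injective vec := by
  intro m n h
  funext i
  have : (m i : ℝ) = n i := congrArg (fun x : EuclideanSpace ℝ (Fin 3) => x i) h
  exact_mod_cast this

theorem exists_lattice : ∃ L : Submodule ℤ (EuclideanSpace ℝ (Fin 3)),
    DiscreteTopology L ∧ Module.finrank ℤ L = 3 ∧ ∀ n, vec n ∈ L := by
  refine ⟨Submodule.span ℤ (range (EuclideanSpace.basisFun (Fin 3) ℝ).toBasis),
    inferInstance, ?_, fun n => ?_⟩
  · rw [ZLattice.rank ℝ, finrank_euclideanSpace_fin]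
  · have : vec n = ∑ i, n i • (EuclideanSpace.basisFun (Fin 3) ℝ).toBasis i := by
      ext j
      simp [vec, Pi.single_apply]
    rw [this]
    exact Submodule.sum_mem _ fun i _ => Submodule.smul_mem _ _ (Submodule.subset_span ⟨i, rfl⟩)

theorem summable_norm_vec_rpow {r : ℝ} (hr : r < -3) :
    Summable fun n : Fin 3 → ℤ => ‖vec n‖ ^ r := by
  obtain ⟨L, _, hL, hmem⟩ := exists_lattice
  have hinj : Function.Injective fun n : Fin 3 → ℤ => (⟨vec n, hmem n⟩ : L) :=
    fun m n h => vec_injective (Subtype.ext_iff.1 h)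
  have h := (ZLattice.summable_norm_rpow L r (by rw [hL]; exact_mod_cast hr)).comp_injective hinj
  simpa only [Function.comp_def] using! h

/-! ### Terms of the representation as incomplete Mellin integrals -/

theorem ofReal_sq_cpow {r : ℝ} (hr : 0 ≤ r) {w s : ℂ} (h : w + w = s) (hs : r ≠ 0) :
    ((r ^ 2 : ℝ) : ℂ) ^ w = (r : ℂ) ^ s := by
  rw [pow_two, Complex.ofReal_mul, Complex.mul_cpow_ofReal_nonneg hr hr,
    ← Complex.cpow_add _ _ (Complex.ofReal_ne_zero.2 hs), h]

theorem norm_vec_ne_zero {n : Fin 3 → ℤ} (hn : n ≠ 0) : ‖vec n‖ ≠ 0 := fun h => by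
  have := one_le_norm_vec_sq hn
  norm_num [h] at this

theorem norm_parity_sign (n : Fin 3 → ℤ) : ‖(-1 : ℂ) ^ parity n‖ = 1 := norm_neg_one_zpow _

theorem positionTerm_eq {u : ℝ} (hu : 0 < u) (s : ℂ) {n : Fin 3 → ℤ} (hn : n ≠ 0) :
    positionTerm u s n = (-1 : ℂ) ^ parity n *
      ∫ t in Ioi u, (t : ℂ) ^ (s / 2 - 1) * ((Real.exp (-(t * ‖vec n‖ ^ 2)) : ℝ) : ℂ) := by
  rw [← cpow_neg_mul_upperGamma (s / 2) (one_pos.trans_le (one_le_norm_vec_sq hn)) hu,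
    Complex.cpow_neg, ofReal_sq_cpow (norm_nonneg _) (add_halves s) (norm_vec_ne_zero hn),
    positionTerm]
  ring

theorem momentumTerm_eq {u : ℝ} (hu : 0 < u) (s : ℂ) (k : antiperiodicMomenta) :
    momentumTerm u s k = ∫ t in Ioi (4 * u)⁻¹, (t : ℂ) ^ ((3 - s) / 2 - 1) *
      ((Real.exp (-(t * ‖(k : EuclideanSpace ℝ (Fin 3))‖ ^ 2)) : ℝ) : ℂ) := by
  rw [← cpow_neg_mul_upperGamma ((3 - s) / 2) (one_pos.trans_le (one_le_norm_momentum_sq k))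
    (by positivity), momentumTerm]
  congr 2
  · ring
  · rw [div_eq_mul_inv, mul_comm]

theorem norm_positionTerm_le {u : ℝ} (hu : 0 < u) (s : ℂ) {n : Fin 3 → ℤ} (hn : n ≠ 0) :
    ‖positionTerm u s n‖ ≤ tailConst u (s / 2).re * Real.exp (-(u * ‖vec n‖ ^ 2)) := by
  rw [positionTerm_eq hu s hn, norm_mul, norm_parity_sign, one_mul]
  exact norm_integral_cpow_mul_exp_le _ hu (one_le_norm_vec_sq hn)

theorem norm_momentumTerm_le {u : ℝ} (hu : 0 < u) (s : ℂ) (k : antiperiodicMomenta) :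
    ‖momentumTerm u s k‖ ≤ tailConst (4 * u)⁻¹ ((3 - s) / 2).re *
      Real.exp (-(‖(k : EuclideanSpace ℝ (Fin 3))‖ ^ 2 / (4 * u))) := by
  rw [momentumTerm_eq hu s k, div_eq_inv_mul (‖(k : EuclideanSpace ℝ (Fin 3))‖ ^ 2)]
  exact norm_integral_cpow_mul_exp_le _ (by positivity) (one_le_norm_momentum_sq k)

theorem summable_norm_positionTerm {u : ℝ} (hu : 0 < u) (s : ℂ) :
    Summable fun n : {n : Fin 3 → ℤ // n ≠ 0} => ‖positionTerm u s n‖ :=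
  Summable.of_nonneg_of_le (fun _ => norm_nonneg _) (fun n => norm_positionTerm_le hu s n.2)
    ((summable_exp_ne_zero hu).mul_left _)

theorem summable_exp_momentum {u : ℝ} (hu : 0 < u) : Summable fun k : antiperiodicMomenta =>
    Real.exp (-((4 * u)⁻¹ * ‖(k : EuclideanSpace ℝ (Fin 3))‖ ^ 2)) :=
  (hasSum_dualTheta (inv_pos.2 (mul_pos four_pos hu))).1

theorem summable_norm_momentumTerm {u : ℝ} (hu : 0 < u) (s : ℂ) :
    Summable fun k : antiperiodicMomenta => ‖momentumTerm u s k‖ := by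
  refine Summable.of_nonneg_of_le (fun _ => norm_nonneg _) (norm_momentumTerm_le hu s)
    (Summable.mul_left _ ?_)
  simpa only [div_eq_inv_mul] using summable_exp_momentum hu

/-- The part of the theta integral beyond the splitting point. -/
noncomputable def positionTail (u : ℝ) : ℝ → ℂ := indicator (Ioi u) fun t => theta t - 1

/-- The dual of the part of the theta integral below the splitting point. -/
noncomputable def momentumTail (u : ℝ) : ℝ → ℂ := indicator (Ioi (4 * u)⁻¹) dualTheta

theorem positionTail_regular {u : ℝ} (hu : 0 < u) (w : ℂ) :
    MellinConvergent (positionTail u) w ∧ DifferentiableAt ℂ (mellin (positionTail u)) w :=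
  mellin_indicator_Ioi_regular (ι := {n : Fin 3 → ℤ // n ≠ 0})
    (q := fun n => ‖vec n‖ ^ 2) (fun n => one_le_norm_vec_sq n.2)
    (fun n => (norm_parity_sign n).le) hu (summable_exp_ne_zero hu)
    (fun _ ht => hasSum_theta_sub_one ht) (continuousOn_theta.sub continuousOn_const) w

theorem hasSum_positionTerm {u : ℝ} (hu : 0 < u) (s : ℂ) :
    HasSum (fun n : {n : Fin 3 → ℤ // n ≠ 0} => positionTerm u s n)
      (mellin (positionTail u) (s / 2)) := by
  refine (hasSum_mellin_indicator_Ioi (ι := {n : Fin 3 → ℤ // n ≠ 0})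
    (q := fun n => ‖vec n‖ ^ 2) (fun n => one_le_norm_vec_sq n.2)
    (fun n => (norm_parity_sign n).le) hu (summable_exp_ne_zero hu)
    (fun _ ht => hasSum_theta_sub_one ht) (s / 2)).congr_fun fun n => ?_
  exact positionTerm_eq hu s n.2

theorem hasSum_dualTheta_one_mul {t : ℝ} (ht : 0 < t) :
    HasSum (fun k : antiperiodicMomenta => (1 : ℂ) *
      ((Real.exp (-(t * ‖(k : EuclideanSpace ℝ (Fin 3))‖ ^ 2)) : ℝ) : ℂ)) (dualTheta t) := by
  simpa only [one_mul] using (hasSum_dualTheta ht).2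

theorem momentumTail_regular {u : ℝ} (hu : 0 < u) (w : ℂ) :
    MellinConvergent (momentumTail u) w ∧ DifferentiableAt ℂ (mellin (momentumTail u)) w :=
  mellin_indicator_Ioi_regular (c := fun _ => 1)
    one_le_norm_momentum_sq (fun _ => by simp) (by positivity) (summable_exp_momentum hu)
    (fun _ ht => hasSum_dualTheta_one_mul ht) continuousOn_dualTheta w

theorem hasSum_momentumTerm {u : ℝ} (hu : 0 < u) (s : ℂ) :
    HasSum (fun k : antiperiodicMomenta => momentumTerm u s k)
      (mellin (momentumTail u) ((3 - s) / 2)) := by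
  refine (hasSum_mellin_indicator_Ioi (c := fun _ => 1)
    one_le_norm_momentum_sq (fun _ => by simp) (by positivity) (summable_exp_momentum hu)
    (fun _ ht => hasSum_dualTheta_one_mul ht) ((3 - s) / 2)).congr_fun fun k => ?_
  rw [one_mul, momentumTerm_eq hu s k]

/-! ### Splitting the Mellin integral -/

theorem hasMellin_one_Ioc_zero {u : ℝ} (hu : 0 < u) {w : ℂ} (hw : 0 < w.re) :
    HasMellin (indicator (Ioc 0 u) fun _ => (1 : ℂ)) w ((u : ℂ) ^ w / w) := by
  have h := hasMellin_one_Ioc hw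
  have he : (indicator (Ioc 0 u) fun _ => (1 : ℂ)) =
      fun t => indicator (Ioc 0 1) (fun _ => (1 : ℂ)) (u⁻¹ * t) := by
    funext t
    have : u⁻¹ * t ∈ Ioc (0 : ℝ) 1 ↔ t ∈ Ioc 0 u := by
      rw [mem_Ioc, mem_Ioc, inv_mul_le_iff₀ hu, mul_one]
      exact and_congr_left fun _ => by simp [hu]
    by_cases ht : t ∈ Ioc 0 u
    · rw [indicator_of_mem ht, indicator_of_mem (this.2 ht)]
    · rw [indicator_of_notMem ht, indicator_of_notMem (mt this.1 ht)]
  rw [he]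
  refine ⟨(MellinConvergent.comp_mul_left (inv_pos.2 hu)).2 h.1, ?_⟩
  rw [mellin_comp_mul_left _ _ (inv_pos.2 hu), h.2, Complex.ofReal_inv,
    Complex.inv_cpow _ _ (by rw [Complex.arg_ofReal_of_nonneg hu.le]; exact Real.pi_pos.ne),
    Complex.cpow_neg, inv_inv, smul_eq_mul, mul_one_div]

/-- The power `t^(-3/2)` shifts the Mellin variable to `(s - 3)/2`, scaling by `4` gives
`4^((3-s)/2) = 2^(3-s)`, and inversion flips the sign of the variable. -/
theorem hasMellin_momentumTail_dual {u : ℝ} (hu : 0 < u) (s : ℂ) :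
    HasMellin (fun t : ℝ => (t : ℂ) ^ (-(3 / 2) : ℂ) • momentumTail u (4 * t)⁻¹) (s / 2)
      (1 / (2 : ℂ) ^ (s - 3) * mellin (momentumTail u) ((3 - s) / 2)) := by
  have hw : -(s / 2 + -(3 / 2)) = (3 - s) / 2 := by ring
  have hc := (momentumTail_regular hu ((3 - s) / 2)).1
  have hinv : MellinConvergent (fun t => momentumTail u t⁻¹) (s / 2 + -(3 / 2)) := by
    have h := (MellinConvergent.comp_rpow (f := momentumTail u) (s := s / 2 + -(3 / 2))
      (a := -1) (by norm_num)).2 (by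
        rw [Complex.ofReal_neg, Complex.ofReal_one, div_neg, div_one, hw]; exact hc)
    simpa only [Real.rpow_neg_one] using h
  constructor
  · rw [MellinConvergent.cpow_smul]
    exact (MellinConvergent.comp_mul_left (f := fun t => momentumTail u t⁻¹) four_pos).2 hinv
  · rw [mellin_cpow_smul,
      mellin_comp_mul_left (fun t => momentumTail u t⁻¹) _ four_pos, mellin_comp_inv, hw,
      smul_eq_mul]
    congr 1
    have h4 : ((4 : ℝ) : ℂ) = ((2 ^ 2 : ℝ) : ℂ) := by norm_num
    rw [h4, ofReal_sq_cpow (s := 3 - s) zero_le_two (by ring) two_ne_zero, one_div,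
      ← Complex.cpow_neg, neg_sub]
    norm_num

theorem mellin_theta_sub_one {u : ℝ} (hu : 0 < u) {s : ℂ} (hs : 0 < s.re) :
    mellin (fun t => theta t - 1) (s / 2) =
      (Real.pi : ℂ) ^ (3 / 2 : ℂ) / (2 : ℂ) ^ (s - 3) * mellin (momentumTail u) ((3 - s) / 2)
        + mellin (positionTail u) (s / 2) - (u : ℂ) ^ (s / 2) / (s / 2) := by
  have h1 := hasMellin_one_Ioc_zero hu (w := s / 2) (by simpa using hs)
  have h2 := hasMellin_momentumTail_dual hu s
  have h3 := hasMellin_const_smul h2.1 ((Real.pi : ℂ) ^ (3 / 2 : ℂ))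
  have h4 := hasMellin_add h3.1 (positionTail_regular hu (s / 2)).1
  have h5 := hasMellin_sub h4.1 h1.1
  rw [h4.2, h3.2, h2.2, h1.2] at h5
  rw [div_eq_mul_one_div ((Real.pi : ℂ) ^ (3 / 2 : ℂ)), mul_assoc, ← smul_eq_mul, ← h5.2]
  refine setIntegral_congr_ae measurableSet_Ioi ?_
  -- At `t = u` both tails vanish but the `Ioc` indicator is `1`, so this null point is discarded.
  filter_upwards [compl_mem_ae_iff.2 (measure_singleton u)] with t htu ht
  have ht0 : (0 : ℝ) < t := ht
  congr 1
  rcases lt_or_gt_of_ne (show t ≠ u from htu) with h | h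
  · have hm : (4 * t)⁻¹ ∈ Ioi (4 * u)⁻¹ := by
      rw [mem_Ioi]
      gcongr
    rw [momentumTail, indicator_of_mem hm, positionTail,
      indicator_of_notMem (by simpa using h.le), indicator_of_mem (mem_Ioc.2 ⟨ht0, h.le⟩),
      theta_eq_dualTheta_inv ht0]
    simp
  · have hm : (4 * t)⁻¹ ∉ Ioi (4 * u)⁻¹ := by
      rw [mem_Ioi, not_lt]
      gcongr
    rw [momentumTail, indicator_of_notMem hm, positionTail, indicator_of_mem (mem_Ioi.2 h),
      indicator_of_notMem fun hh => absurd hh.2 (not_le.2 h)]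
    simp

/-! ### The entire continuation and its uniqueness -/

theorem summable_norm_zetaTerm {s : ℂ} (hs : 3 < s.re) :
    Summable fun n : {n : Fin 3 → ℤ // n ≠ 0} => ‖zetaTerm s n‖ := by
  refine ((summable_norm_vec_rpow (neg_lt_neg hs)).subtype {n | n ≠ 0}).congr fun n => ?_
  rw [zetaTerm, norm_div, norm_parity_sign, Complex.norm_cpow_eq_rpow_re_of_pos
    ((norm_nonneg _).lt_of_ne' (norm_vec_ne_zero n.2)), Function.comp_apply,
    Real.rpow_neg (norm_nonneg _), one_div]

theorem Gamma_mul_tsum_zetaTerm {s : ℂ} (hs : 3 < s.re) :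
    Complex.Gamma (s / 2) * ∑' n : {n : Fin 3 → ℤ // n ≠ 0}, zetaTerm s n =
      mellin (fun t => theta t - 1) (s / 2) := by
  have h2 : (s / 2).re = s.re / 2 := by simp
  have h := hasSum_mellin (ι := {n : Fin 3 → ℤ // n ≠ 0}) (a := fun n => (-1 : ℂ) ^ parity n)
    (p := fun n => ‖vec n‖ ^ 2) (F := fun t => theta t - 1) (s := s / 2)
    (fun n => Or.inr (one_pos.trans_le (one_le_norm_vec_sq n.2))) (by rw [h2]; linarith)
    (fun t ht => (hasSum_theta_sub_one ht).congr_fun fun n => by rw [neg_mul, mul_comm t])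
    ((summable_norm_zetaTerm hs).congr fun n => by
      rw [zetaTerm, norm_div, Complex.norm_cpow_eq_rpow_re_of_pos
        ((norm_nonneg _).lt_of_ne' (norm_vec_ne_zero n.2)), h2, ← Real.rpow_natCast,
        ← Real.rpow_mul (norm_nonneg _)]
      norm_num
      ring_nf)
  rw [← h.tsum_eq, ← tsum_mul_left]
  refine tsum_congr fun n => ?_
  rw [ofReal_sq_cpow (norm_nonneg _) (add_halves s) (norm_vec_ne_zero n.2), zetaTerm, mul_div_assoc]

/-- The entire function given by the rapidly converging representation with splitting point `u`. -/
noncomputable def xi (u : ℝ) (s : ℂ) : ℂ :=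
  (Complex.Gamma (s / 2))⁻¹ *
    ((Real.pi : ℂ) ^ (3 / 2 : ℂ) / (2 : ℂ) ^ (s - 3) * mellin (momentumTail u) ((3 - s) / 2)
      + mellin (positionTail u) (s / 2)) - (u : ℂ) ^ (s / 2) * (Complex.Gamma (s / 2 + 1))⁻¹

theorem differentiable_xi {u : ℝ} (hu : 0 < u) : Differentiable ℂ (xi u) := by
  have hG := Complex.differentiable_one_div_Gamma
  have hM : Differentiable ℂ (mellin (momentumTail u)) := fun w => (momentumTail_regular hu w).2
  have hP : Differentiable ℂ (mellin (positionTail u)) := fun w => (positionTail_regular hu w).2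
  have h1 : Differentiable ℂ fun s : ℂ => (Complex.Gamma (s / 2))⁻¹ :=
    hG.comp (f := fun s : ℂ => s / 2) (by fun_prop)
  have h2 : Differentiable ℂ fun s : ℂ => (Complex.Gamma (s / 2 + 1))⁻¹ :=
    hG.comp (f := fun s : ℂ => s / 2 + 1) (by fun_prop)
  have h3 : Differentiable ℂ fun s : ℂ => mellin (momentumTail u) ((3 - s) / 2) :=
    hM.comp (f := fun s : ℂ => (3 - s) / 2) (by fun_prop)
  have h4 : Differentiable ℂ fun s : ℂ => mellin (positionTail u) (s / 2) :=
    hP.comp (f := fun s : ℂ => s / 2) (by fun_prop)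
  have h5 : Differentiable ℂ fun s : ℂ => (u : ℂ) ^ (s / 2) := fun s =>
    (by fun_prop : DifferentiableAt ℂ (fun s : ℂ => s / 2) s).const_cpow
      (Or.inl (Complex.ofReal_ne_zero.2 hu.ne'))
  have h6 : Differentiable ℂ fun s : ℂ => (2 : ℂ) ^ (s - 3) := fun s =>
    (by fun_prop : DifferentiableAt ℂ (fun s : ℂ => s - 3) s).const_cpow (Or.inl two_ne_zero)
  have h7 : ∀ s : ℂ, (2 : ℂ) ^ (s - 3) ≠ 0 := fun s => by simp [Complex.cpow_eq_zero_iff]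
  exact (h1.mul ((((differentiable_const _).div h6 h7).mul h3).add h4)).sub (h5.mul h2)

/-- This trades the apparent pole at `s = 0` for the entire function `1/Γ(s/2 + 1)` used in `xi`. It
also holds at the poles of `Γ`, where `Complex.Gamma` is `0` and so is its inverse. -/
theorem inv_Gamma_add_one {w : ℂ} (hw : w ≠ 0) :
    (Complex.Gamma (w + 1))⁻¹ = (Complex.Gamma w)⁻¹ / w := by
  rw [Complex.Gamma_add_one w hw, mul_inv, div_eq_inv_mul]

theorem xi_eq_tsum {u : ℝ} (hu : 0 < u) {s : ℂ} (hs : 3 < s.re) :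
    xi u s = ∑' n : {n : Fin 3 → ℤ // n ≠ 0}, zetaTerm s n := by
  have hs2 : 0 < (s / 2).re := by
    have : (s / 2).re = s.re / 2 := by simp
    rw [this]
    linarith
  have hs0 : s / 2 ≠ 0 := fun h => by simp [h] at hs2
  have hG := Complex.Gamma_ne_zero_of_re_pos hs2
  have h := Gamma_mul_tsum_zetaTerm hs
  rw [mellin_theta_sub_one hu (by linarith)] at h
  rw [← inv_mul_cancel_left₀ hG (∑' n : {n : Fin 3 → ℤ // n ≠ 0}, zetaTerm s n), h, xi,
    inv_Gamma_add_one hs0]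
  ring

theorem isZetaContinuation_xi {u : ℝ} (hu : 0 < u) : IsZetaContinuation (xi u) where
  meromorphic s _ := ((differentiable_xi hu).analyticAt s).meromorphicNFAt
  eq_series _ hs := xi_eq_tsum hu hs

/-- A meromorphic function in normal form on `ℂ` which agrees near one point with an entire
function is equal to it. -/
theorem eq_of_meromorphicNFOn_of_eventuallyEq {f g : ℂ → ℂ} (hf : MeromorphicNFOn f univ)
    (hg : Differentiable ℂ g) {z : ℂ} (h : f =ᶠ[𝓝 z] g) : f = g := by
  have hgm : MeromorphicOn g univ := fun x _ => (hg.analyticAt x).meromorphicAt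
  have hfm : MeromorphicOn f univ := fun x hx => (hf hx).meromorphicAt
  have hd : MeromorphicOn (f - g) univ := hfm.sub hgm
  have hz : meromorphicOrderAt (f - g) z = ⊤ := by
    rw [meromorphicOrderAt_eq_top_iff]
    filter_upwards [nhdsWithin_le_nhds h] with x hx
    simp [hx]
  funext x
  -- Infinite order means vanishing on a punctured neighbourhood. It spreads from `z` because the
  -- plane is connected, and the normal form then fixes the value at `x` itself.
  have hx : meromorphicOrderAt (f - g) x = ⊤ := by
    by_contra hne
    exact hd.meromorphicOrderAt_ne_top_of_isPreconnected isPreconnected_univ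
      (mem_univ x) (mem_univ z) hne hz
  rw [meromorphicOrderAt_eq_top_iff] at hx
  have hx' : f =ᶠ[𝓝[≠] x] g := by
    filter_upwards [hx] with y hy
    exact sub_eq_zero.1 hy
  exact (((hf (mem_univ x)).eventuallyEq_nhdsNE_iff_eventuallyEq_nhds
    (hg.analyticAt x).meromorphicNFAt).1 hx').eq_of_nhds

/-- Since `ξ` does not involve `u`, all `xi u` coincide. Holomorphy can thus be read off at `u = 1`
and the representation at any `u`. -/
theorem IsZetaContinuation.eq_xi {ξ : ℂ → ℂ} (hξ : IsZetaContinuation ξ) {u : ℝ} (hu : 0 < u) :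
    ξ = xi u := by
  refine eq_of_meromorphicNFOn_of_eventuallyEq hξ.meromorphic (differentiable_xi hu) (z := 4) ?_
  have : {s : ℂ | 3 < s.re} ∈ 𝓝 (4 : ℂ) :=
    (isOpen_lt continuous_const Complex.continuous_re).mem_nhds (by norm_num)
  filter_upwards [this] with s hs
  rw [hξ.eq_series s hs, xi_eq_tsum hu hs]

theorem xi_eq_representation {u : ℝ} (hu : 0 < u) {s : ℂ} (hs : s ≠ 0) :
    xi u s = 1 / Complex.Gamma (s / 2) *
      (-(2 * (u : ℂ) ^ (s / 2) / s)
        + (Real.pi : ℂ) ^ (3 / 2 : ℂ) / (2 : ℂ) ^ (s - 3) *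
            ∑' k : antiperiodicMomenta, momentumTerm u s k
        + ∑' n : {n : Fin 3 → ℤ // n ≠ 0}, positionTerm u s n) := by
  rw [(hasSum_momentumTerm hu s).tsum_eq, (hasSum_positionTerm hu s).tsum_eq, xi,
    inv_Gamma_add_one (div_ne_zero hs two_ne_zero), div_div_eq_mul_div]
  ring

end LatticeZeta

theorem mainTheorem6 :
    -- the defining series converges absolutely for `Re s > 3`
    (∀ s : ℂ, 3 < s.re →
      Summable (fun n : {n : Fin 3 → ℤ // n ≠ 0} => ‖LatticeZeta.zetaTerm s n‖)) ∧
    -- it has one and only one meromorphic continuation to `ℂ`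
    (∃! ξ : ℂ → ℂ, LatticeZeta.IsZetaContinuation ξ) ∧
    ∀ ξ : ℂ → ℂ, LatticeZeta.IsZetaContinuation ξ →
      -- the continuation is holomorphic for `Re s > 0`
      DifferentiableOn ℂ ξ {s : ℂ | 0 < s.re} ∧
      ∀ u : ℝ, 0 < u → ∀ s : ℂ,
        -- both sums of the representation converge absolutely, with Gaussian decay of the terms
        Summable (fun k : LatticeZeta.antiperiodicMomenta =>
          ‖LatticeZeta.momentumTerm u s k‖) ∧
        Summable (fun n : {n : Fin 3 → ℤ // n ≠ 0} => ‖LatticeZeta.positionTerm u s n‖) ∧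
        (∃ C : ℝ, ∀ k ∈ LatticeZeta.antiperiodicMomenta,
          ‖LatticeZeta.momentumTerm u s k‖ ≤ C * Real.exp (-(‖k‖ ^ 2 / (4 * u)))) ∧
        (∃ C : ℝ, ∀ n : Fin 3 → ℤ, n ≠ 0 →
          ‖LatticeZeta.positionTerm u s n‖ ≤ C * Real.exp (-(u * ‖LatticeZeta.vec n‖ ^ 2))) ∧
        -- the representation
        (s ≠ 0 →
          ξ s = 1 / Complex.Gamma (s / 2) *
            (-(2 * (u : ℂ) ^ (s / 2) / s)
              + (Real.pi : ℂ) ^ (3 / 2 : ℂ) / (2 : ℂ) ^ (s - 3) *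
                  ∑' k : LatticeZeta.antiperiodicMomenta, LatticeZeta.momentumTerm u s k
              + ∑' n : {n : Fin 3 → ℤ // n ≠ 0}, LatticeZeta.positionTerm u s n)) := by
  refine ⟨fun s hs => LatticeZeta.summable_norm_zetaTerm hs,
    ⟨LatticeZeta.xi 1, LatticeZeta.isZetaContinuation_xi one_pos, fun ξ hξ => hξ.eq_xi one_pos⟩,
    fun ξ hξ => ⟨?_, fun u hu s => ⟨LatticeZeta.summable_norm_momentumTerm hu s,
      LatticeZeta.summable_norm_positionTerm hu s,
      ⟨_, fun k hk => LatticeZeta.norm_momentumTerm_le hu s ⟨k, hk⟩⟩,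
      ⟨_, fun n hn => LatticeZeta.norm_positionTerm_le hu s hn⟩, fun hs => ?_⟩⟩⟩
  · rw [hξ.eq_xi one_pos]
    exact (LatticeZeta.differentiable_xi one_pos).differentiableOn
  · rw [hξ.eq_xi hu]
    exact LatticeZeta.xi_eq_representation hu hs
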